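/- All graphs are finite and simple. Two distinct letters $a,b$ *alternate* in a word $w$ if the subword of $w$ formed by all occurrences of $a$ and $b$ is of the form $abab\cdots$ or $baba\cdots$ (of even or odd length). A word $w$ over the vertex set $V$ *represents* a graph $G=(V,E)$ if, for all distinct $a,b\in V$, $\{a,b\}\in E$ if and only if $a$ and $b$ alternate in $w$; $G$ is *word-representable* if some word represents it, and *$k$-word-representable* if it is represented by a word in which every vertex occurs exactly $k$ times. The *representation number* $\mathcal{R}(G)$ of a word-representable graph $G$ is the smallest positive integer $k$ such that $G$ is $k$-word-representable. A *melon graph* $M=(E_1,\ldots,E_m)$, $m\ge 1$, is a simple graph that is the union of distinct paths $E_1,\ldots,E_m$ (its *constituent paths*) having two common endpoints $0\ne 0'$ and pairwise sharing no other vertices. The *line graph* $L(M)$ has the edges of $M$ as vertices, two of them being adjacent if and only if they are distinct and share an endpoint in $M$. **Theorem.** Let $M=(E_1,\ldots,E_m)$ be a melon graph whose line graph $L(M)$ is word-representable. Then $\mathcal{R}(L(M))\le 3$. Moreover, $\mathcal{R}(L(M))=3$ if and only if at least three of the constituent paths $E_1,\ldots,E_m$ have length at least two. -/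

import Mathlib

/-- Two distinct letters `a` and `b` alternate in the word `w`: the subword of `w` consisting of all
occurrences of `a` and `b` is `abab⋯` or `baba⋯` (of even or odd length), i.e. no two consecutive
letters of that subword are equal. -/
def Alternate {V : Type*} (w : List V) (a b : V) : Prop :=
  open Classical in (w.filter fun x => x = a ∨ x = b).IsChain (· ≠ ·)

/-- The word `w` over the vertex set represents the graph `G`: two distinct vertices are adjacent
if and only if they alternate in `w`. -/
def Represents {V : Type*} (w : List V) (G : SimpleGraph V) : Prop :=
  ∀ a b : V, a ≠ b → (G.Adj a b ↔ Alternate w a b)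

def IsWordRepresentable {V : Type*} (G : SimpleGraph V) : Prop :=
  ∃ w : List V, Represents w G

/-- Every letter of the alphabet `V` occurs exactly `k` times in `w`. -/
def IsUniform {V : Type*} (k : ℕ) (w : List V) : Prop :=
  open Classical in ∀ a : V, w.count a = k

def IsKWordRepresentable {V : Type*} (k : ℕ) (G : SimpleGraph V) : Prop :=
  ∃ w : List V, IsUniform k w ∧ Represents w G

/-- The representation number of `G`: the smallest positive integer `k` such that `G` is
`k`-word-representable; it is `⊤` if there is no such `k`. -/
noncomputable def representationNumber {V : Type*} (G : SimpleGraph V) : ℕ∞ :=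
  ⨅ k : ℕ, ⨅ _ : 1 ≤ k ∧ IsKWordRepresentable k G, (k : ℕ∞)

/-- The (simple) graph `M` is the melon graph `(E 0, …, E (m - 1))`: it is the union of the
distinct paths `E i`, which have two common endpoints `s ≠ t` and are otherwise vertex-disjoint.
(Since `V` contains `s`, the field `vertex_mem` forces `1 ≤ m`.) -/
structure IsMelonGraph {V : Type*} (M : SimpleGraph V) {m : ℕ} {s t : V}
    (E : Fin m → M.Path s t) : Prop where
  endpoints_ne : s ≠ t
  paths_injective : Function.Injective E
  internally_disjoint : ∀ i j : Fin m, i ≠ j → ∀ v : V,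
    v ∈ (E i : M.Walk s t).support → v ∈ (E j : M.Walk s t).support → v = s ∨ v = t
  vertex_mem : ∀ v : V, ∃ i : Fin m, v ∈ (E i : M.Walk s t).support
  edge_mem : ∀ e ∈ M.edgeSet, ∃ i : Fin m, e ∈ (E i : M.Walk s t).edges

/-! Coding an edge of the melon by its path and its position there turns adjacency in `L(M)` into
arithmetic: consecutive on one path, both first, or both last. So `L(M)` consists of two cliques,
the first edges and the last edges, joined by paths; the edge of a path of length one belongs to
both cliques.

Upper bound: explicit words. If no path has length one, a 3-uniform word always exists
(`isKWordRepresentable_three_of_two_le`). Otherwise let `e` be the edge of the only path of length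
one. Neighbourhoods in a word-representable graph induce comparability graphs
(`exists_comparability`), but three paths of length two would put into the neighbourhood of `e` a
triangle whose vertices have private neighbours. Hence at most two paths have length two, which is
exactly what the word of `isKWordRepresentable_three_of_card_le` can accommodate.

Dichotomy: a 2-uniform word is a chord diagram. Given three paths of length at least two, their
first edges are three pairwise crossing chords. For each of them, the parts of the other two paths
beyond their first edges are connected through the last edges and avoid the chord, so they lie on
one side of it. The three second edges, each crossing only the first edge of its own path, then
impose contradictory sides (`false_of_triangles`). With at most two such paths, an explicit
2-uniform word exists. -/

/-! ### Alternation by separation and by prefix counts -/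

section Alternation

variable {V : Type*}

theorem alternate_cons_of_ne {w : List V} {a b c : V} (ha : c ≠ a) (hb : c ≠ b) :
    Alternate (c :: w) a b ↔ Alternate w a b := by
  classical
  simp [Alternate, ha, hb]

theorem alternate_comm {w : List V} {a b : V} : Alternate w a b ↔ Alternate w b a := by
  classical
  have : (fun x => decide (x = a ∨ x = b)) = fun x => decide (x = b ∨ x = a) :=
    funext fun x => decide_eq_decide.2 or_comm
  unfold Alternate
  convert Iff.rfl using 3
  exact this.symm

open Classical in
theorem alternate_cons_self {w : List V} {a b : V} :
    Alternate (a :: w) a b ↔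
      Alternate w a b ∧ (w.filter fun x => x = a ∨ x = b).head? ≠ some a := by
  rw [Alternate, Alternate, List.filter_cons_of_pos (by simp), List.isChain_cons, and_comm]
  refine and_congr_right fun _ => ⟨fun h h' => h a h' rfl, fun h y hy hay => h (hay ▸ hy)⟩

open Classical in
theorem head?_filter_eq_some_iff {w : List V} {a b : V} (hab : a ≠ b) :
    (w.filter fun x => x = a ∨ x = b).head? = some a ↔
      ∃ q : ℕ, w[q]? = some a ∧ ∀ r < q, w[r]? ≠ some b := by
  induction w with
  | nil => simp
  | cons c w ih =>
    by_cases hca : c = a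
    · subst hca
      simp only [true_or, decide_true, List.filter_cons_of_pos, List.head?_cons, true_iff]
      exact ⟨0, by simp, by simp⟩
    by_cases hcb : c = b
    · subst hcb
      rw [List.filter_cons_of_pos (by simp)]
      simp only [List.head?_cons, Option.some.injEq, hca, false_iff]
      rintro ⟨q, hq, h⟩
      cases q with
      | zero => simp [hca] at hq
      | succ q => exact h 0 (by omega) (by simp)
    · rw [List.filter_cons_of_neg (by simp [hca, hcb]), ih]
      constructor
      · rintro ⟨q, hq, h⟩
        refine ⟨q + 1, by simpa using hq, fun r hr => ?_⟩
        cases r with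
        | zero => simpa using hcb
        | succ r => simpa using h r (by omega)
      · rintro ⟨q, hq, h⟩
        cases q with
        | zero => simp [hca] at hq
        | succ q =>
          exact ⟨q, by simpa using hq, fun r hr => by simpa using h (r + 1) (by omega)⟩

/-- Between any two occurrences of `a` in `w` there is an occurrence of `b`. -/
def Separates (w : List V) (b a : V) : Prop :=
  ∀ p q : ℕ, p < q → w[p]? = some a → w[q]? = some a → ∃ r, p < r ∧ r < q ∧ w[r]? = some b

theorem separates_cons_of_ne {w : List V} {a b c : V} (hca : c ≠ a) :
    Separates (c :: w) b a ↔ Separates w b a := by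
  constructor
  · intro h p q hpq hp hq
    obtain ⟨r, h1, h2, h3⟩ := h (p + 1) (q + 1) (by omega) (by simpa using hp) (by simpa using hq)
    cases r with
    | zero => omega
    | succ r => exact ⟨r, by omega, by omega, by simpa using h3⟩
  · intro h p q hpq hp hq
    cases p with
    | zero => simp [hca] at hp
    | succ p =>
      cases q with
      | zero => omega
      | succ q =>
        obtain ⟨r, h1, h2, h3⟩ := h p q (by omega) (by simpa using hp) (by simpa using hq)
        exact ⟨r + 1, by omega, by omega, by simpa using h3⟩

theorem separates_cons_self {w : List V} {a b : V} :
    Separates (a :: w) b a ↔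
      Separates w b a ∧ ∀ q : ℕ, w[q]? = some a → ∃ r < q, w[r]? = some b := by
  constructor
  · intro h
    constructor
    · intro p q hpq hp hq
      obtain ⟨r, h1, h2, h3⟩ :=
        h (p + 1) (q + 1) (by omega) (by simpa using hp) (by simpa using hq)
      cases r with
      | zero => omega
      | succ r => exact ⟨r, by omega, by omega, by simpa using h3⟩
    · intro q hq
      obtain ⟨r, h1, h2, h3⟩ := h 0 (q + 1) (by omega) (by simp) (by simpa using hq)
      cases r with
      | zero => omega
      | succ r => exact ⟨r, by omega, by simpa using h3⟩
  · rintro ⟨h, h'⟩ p q hpq hp hq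
    cases q with
    | zero => omega
    | succ q =>
      cases p with
      | zero =>
        obtain ⟨r, h2, h3⟩ := h' q (by simpa using hq)
        exact ⟨r + 1, by omega, by omega, by simpa using h3⟩
      | succ p =>
        obtain ⟨r, h1, h2, h3⟩ := h p q (by omega) (by simpa using hp) (by simpa using hq)
        exact ⟨r + 1, by omega, by omega, by simpa using h3⟩

/-- This form mentions positions only, so it carries over to occurrence times in any linear order.
-/
theorem alternate_iff_separates {w : List V} {a b : V} (hab : a ≠ b) :
    Alternate w a b ↔ Separates w b a ∧ Separates w a b := by
  induction w with
  | nil => simp [Alternate, Separates]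
  | cons c w ih =>
    have key : ∀ a b : V, a ≠ b → (Alternate (a :: w) a b ↔ Alternate w a b ∧
        ∀ q : ℕ, w[q]? = some a → ∃ r < q, w[r]? = some b) := by
      intro a b hab
      rw [alternate_cons_self, Ne, head?_filter_eq_some_iff hab]
      push Not
      rfl
    by_cases hca : c = a
    · subst hca
      rw [key _ _ hab, separates_cons_self, separates_cons_of_ne hab, ih]
      tauto
    by_cases hcb : c = b
    · subst hcb
      rw [alternate_comm, key _ _ hab.symm, alternate_comm, separates_cons_self,
        separates_cons_of_ne hab.symm, ih]
      tauto
    · rw [alternate_cons_of_ne hca hcb, separates_cons_of_ne hca, separates_cons_of_ne hcb, ih]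

/-- In every prefix of `w` the letter `a` occurs as often as `b` or once more. -/
def Leads (w : List V) (a b : V) : Prop :=
  open Classical in ∀ n, (w.take n).count b ≤ (w.take n).count a ∧
    (w.take n).count a ≤ (w.take n).count b + 1

theorem leads_cons_self {w : List V} {a b : V} (hab : a ≠ b) :
    Leads (a :: w) a b ↔ Leads w b a := by
  classical
  constructor
  · intro h n
    have := h (n + 1)
    simp only [List.take_succ_cons, List.count_cons_self, List.count_cons_of_ne hab] at this
    omega
  · intro h n
    cases n with
    | zero => simp
    | succ n =>
      have := h n
      simp only [List.take_succ_cons, List.count_cons_self, List.count_cons_of_ne hab]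
      omega

theorem leads_cons_of_ne {w : List V} {a b c : V} (hca : c ≠ a) (hcb : c ≠ b) :
    Leads (c :: w) a b ↔ Leads w a b := by
  classical
  constructor
  · intro h n
    have := h (n + 1)
    simpa only [List.take_succ_cons, List.count_cons_of_ne hca,
      List.count_cons_of_ne hcb] using this
  · intro h n
    cases n with
    | zero => simp
    | succ n =>
      simpa only [List.take_succ_cons, List.count_cons_of_ne hca,
        List.count_cons_of_ne hcb] using h n

theorem not_leads_cons_self {w : List V} {a b : V} (hab : a ≠ b) : ¬ Leads (a :: w) b a := by
  classical
  intro h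
  have := h 1
  simp [hab] at this

open Classical in
theorem leads_iff {w : List V} {a b : V} (hab : a ≠ b) :
    Leads w a b ↔ Alternate w a b ∧ (w.filter fun x => x = a ∨ x = b).head? ≠ some b := by
  induction w generalizing a b with
  | nil => simp [Alternate, Leads]
  | cons c w ih =>
    by_cases hca : c = a
    · subst hca
      rw [leads_cons_self hab, ih hab.symm, alternate_cons_self, alternate_comm]
      simp only [or_comm, List.filter_cons]
      simp [hab]
    by_cases hcb : c = b
    · subst hcb
      simp [not_leads_cons_self hab.symm]
    · rw [leads_cons_of_ne hca hcb, ih hab, alternate_cons_of_ne hca hcb,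
        List.filter_cons_of_neg (by simp [hca, hcb])]

/-- In this form alternation is a family of linear inequalities between prefix counts, from which a
transitive relation can be built. -/
theorem alternate_iff_leads {w : List V} {a b : V} (hab : a ≠ b) :
    Alternate w a b ↔ Leads w a b ∨ Leads w b a := by
  classical
  rw [leads_iff hab, leads_iff hab.symm, alternate_comm (a := b), ← and_or_left]
  have : (fun x => decide (x = b ∨ x = a)) = fun x => decide (x = a ∨ x = b) :=
    funext fun x => decide_eq_decide.2 or_comm
  rw [this]
  refine ⟨fun h => ⟨h, ?_⟩, fun h => h.1⟩
  by_contra! h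
  exact hab (Option.some_injective _ (h.2.symm.trans h.1))

end Alternation

/-! ### Uniform words as families of occurrence times -/

section Keys

variable {V : Type*}

/-- The occurrences of `a` and `b`, listed in increasing order by `f a` and `f b`, alternate. -/
def KeysAlternate {α : Type*} [LT α] {k : ℕ} (f : V → Fin k → α) (a b : V) : Prop :=
  (∀ i j, i < j → ∃ l, f a i < f b l ∧ f b l < f a j) ∧
    (∀ i j, i < j → ∃ l, f b i < f a l ∧ f a l < f b j)

/-- A family of occurrence times that represents `G` gives rise to a uniform word. -/
theorem isKWordRepresentable_of_keys [Finite V] {G : SimpleGraph V} {α : Type*} [LinearOrder α]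
    {k : ℕ} (f : V → Fin k → α) (hmono : ∀ a, StrictMono (f a))
    (hinj : ∀ a b i j, f a i = f b j → a = b)
    (hG : ∀ a b, a ≠ b → (G.Adj a b ↔ KeysAlternate f a b)) : IsKWordRepresentable k G := by
  classical
  have := Fintype.ofFinite V
  have finj : Function.Injective fun x : V × Fin k => f x.1 x.2 := by
    rintro ⟨a, i⟩ ⟨b, j⟩ h
    obtain rfl := hinj a b i j h
    simpa using (hmono a).injective h
  -- Occurrences are ordered by their times; the word is the sorted list of occurrences, read letter
  -- by letter.
  let _ : LinearOrder (V × Fin k) := LinearOrder.lift' _ finj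
  have lt_iff : ∀ x y : V × Fin k, x < y ↔ f x.1 x.2 < f y.1 y.2 := fun _ _ => Iff.rfl
  set l := (Finset.univ : Finset (V × Fin k)).sort (· ≤ ·) with hl
  have hsorted : l.SortedLT := Finset.sortedLT_sort _
  have hget : ∀ p q (hp : p < l.length) (hq : q < l.length), l[p] < l[q] ↔ p < q :=
    fun p q hp hq => (hsorted.strictMono_get.lt_iff_lt (a := ⟨p, hp⟩) (b := ⟨q, hq⟩))
  have hmem : ∀ x : V × Fin k, ∃ p, ∃ hp : p < l.length, l[p] = x := fun x =>
    List.mem_iff_getElem.1 (by simp [hl])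
  have hsep : ∀ a b, Separates (l.map Prod.fst) b a ↔
      ∀ i j, i < j → ∃ m, f a i < f b m ∧ f b m < f a j := by
    intro a b
    constructor
    · intro h i j hij
      obtain ⟨p, hp, hpi⟩ := hmem (a, i)
      obtain ⟨q, hq, hqj⟩ := hmem (a, j)
      have hpq : p < q := by
        rw [← hget p q hp hq, hpi, hqj, lt_iff]
        exact hmono a hij
      obtain ⟨r, h1, h2, h3⟩ := h p q hpq (by simp [hp, hpi]) (by simp [hq, hqj])
      have hr : r < l.length := h2.trans hq
      have hb : l[r].1 = b := by simpa [hr] using h3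
      refine ⟨l[r].2, ?_, ?_⟩
      · have := (hget p r hp hr).2 h1
        rwa [lt_iff, hpi, hb] at this
      · have := (hget r q hr hq).2 h2
        rwa [lt_iff, hqj, hb] at this
    · intro h p q hpq hpa hqa
      obtain ⟨x, hx, hxa⟩ : ∃ x, l[p]? = some x ∧ x.1 = a := by simpa using hpa
      obtain ⟨y, hy, hya⟩ : ∃ y, l[q]? = some y ∧ y.1 = a := by simpa using hqa
      obtain ⟨hp, rfl⟩ := List.getElem?_eq_some_iff.1 hx
      obtain ⟨hq, rfl⟩ := List.getElem?_eq_some_iff.1 hy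
      have hlt := (hget p q hp hq).2 hpq
      rw [lt_iff, hxa, hya, (hmono a).lt_iff_lt] at hlt
      obtain ⟨m, h1, h2⟩ := h _ _ hlt
      obtain ⟨r, hr, hrm⟩ := hmem (b, m)
      refine ⟨r, ?_, ?_, by simp [hr, hrm]⟩
      · rw [← hget p r hp hr, hrm, lt_iff, hxa]
        exact h1
      · rw [← hget r q hr hq, hrm, lt_iff, hya]
        exact h2
  refine ⟨l.map Prod.fst, fun a => ?_, fun a b hab => ?_⟩
  · have : (l.map Prod.fst).count a =
        ((Finset.univ : Finset (V × Fin k)).filter fun x => x.1 = a).card := by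
      rw [Finset.card_def, Finset.filter_val, ← Finset.sort_eq Finset.univ (· ≤ ·),
        Multiset.filter_coe, Multiset.coe_card, ← hl, List.count, List.countP_map,
        List.countP_eq_length_filter]
      congr 1
    convert this
    have h2 : ((Finset.univ : Finset (V × Fin k)).filter fun x => x.1 = a) =
        {a} ×ˢ Finset.univ := by
      ext ⟨x, i⟩
      simp [eq_comm]
    rw [h2]
    simp
  · rw [hG a b hab, alternate_iff_separates hab, hsep, hsep, KeysAlternate]

/-- The occurrence times of the letters in a uniform word. -/
theorem IsKWordRepresentable.exists_keys {G : SimpleGraph V} {k : ℕ}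
    (h : IsKWordRepresentable k G) : ∃ f : V → Fin k → ℕ, (∀ a, StrictMono (f a)) ∧
      (∀ a b i j, f a i = f b j → a = b) ∧
      ∀ a b, a ≠ b → (G.Adj a b ↔ KeysAlternate f a b) := by
  classical
  obtain ⟨w, hw, hG⟩ := h
  have hcard : ∀ a, ((Finset.range w.length).filter fun p => w[p]? = some a).card = k := by
    intro a
    rw [← hw a]
    clear hw hG
    induction w using List.reverseRecOn with
    | nil => simp
    | append_singleton w c ih =>
      rw [List.length_append, List.length_singleton, Finset.range_add_one, Finset.filter_insert,
        List.count_append]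
      have : (Finset.range w.length).filter (fun p => (w ++ [c])[p]? = some a) =
          (Finset.range w.length).filter fun p => w[p]? = some a := by
        refine Finset.filter_congr fun p hp => ?_
        rw [List.getElem?_append_left (by simpa using hp)]
      rw [this]
      by_cases hca : c = a
      · rw [if_pos (by simp [hca]), Finset.card_insert_of_notMem (by simp), ih, hca]
        simp
      · rw [if_neg (by simp [hca]), ih]
        simp [hca]
  let f : V → Fin k → ℕ := fun a => Finset.orderEmbOfFin _ (hcard a)
  have hf : ∀ a p, w[p]? = some a ↔ ∃ i, f a i = p := by
    intro a p
    have := Finset.range_orderEmbOfFin _ (hcard a)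
    rw [← Set.mem_range, this]
    simp only [Finset.coe_filter, Finset.mem_range, Set.mem_ofPred_eq]
    exact ⟨fun h => ⟨(List.getElem?_eq_some_iff.1 h).1, h⟩, And.right⟩
  have hmono : ∀ a, StrictMono (f a) := fun a => OrderEmbedding.strictMono _
  have hsep : ∀ a b, Separates w b a ↔ ∀ i j, i < j → ∃ m, f a i < f b m ∧ f b m < f a j := by
    intro a b
    simp only [Separates, hf]
    constructor
    · intro h i j hij
      obtain ⟨r, h1, h2, m, rfl⟩ := h _ _ (hmono a hij) ⟨i, rfl⟩ ⟨j, rfl⟩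
      exact ⟨m, h1, h2⟩
    · rintro h _ _ hpq ⟨i, rfl⟩ ⟨j, rfl⟩
      obtain ⟨m, h1, h2⟩ := h i j ((hmono a).lt_iff_lt.1 hpq)
      exact ⟨_, h1, h2, m, rfl⟩
  refine ⟨f, hmono, fun a b i j hij => ?_, fun a b hab => ?_⟩
  · have h1 := (hf a _).2 ⟨i, rfl⟩
    have h2 := (hf b _).2 ⟨j, hij.symm⟩
    simpa [h1] using h2
  · rw [hG a b hab, alternate_iff_separates hab, hsep, hsep, KeysAlternate]

end Keys

/-! ### Coordinates on the line graph of a melon -/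

section MelonCoordinates

/-- `G` is the line graph of a melon graph whose paths `i : ι` have lengths `L i`: the vertex `e` is
the edge number `j e` of the path `p e`. -/
structure IsMelonLineGraph {U ι : Type*} (G : SimpleGraph U) (L : ι → ℕ) (p : U → ι)
    (j : U → ℕ) : Prop where
  lt : ∀ e, j e < L (p e)
  inj : ∀ e e', p e = p e' → j e = j e' → e = e'
  surj : ∀ i n, n < L i → ∃ e, p e = i ∧ j e = n
  adj : ∀ e e', e ≠ e' → (G.Adj e e' ↔ (p e = p e' ∧ (j e + 1 = j e' ∨ j e' + 1 = j e)) ∨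
    (j e = 0 ∧ j e' = 0) ∨ (j e + 1 = L (p e) ∧ j e' + 1 = L (p e')))
  eq_of_one : ∀ i i', L i = 1 → L i' = 1 → i = i'
  pos : ∀ i, 0 < L i

namespace IsMelonGraph

variable {V : Type*} {M : SimpleGraph V} {m : ℕ} {s t : V} {E : Fin m → M.Path s t}

theorem length_pos (hM : IsMelonGraph M E) (i : Fin m) : 0 < (E i : M.Walk s t).length := by
  by_contra! h
  exact hM.endpoints_ne (SimpleGraph.Walk.eq_of_length_eq_zero (p := (E i : M.Walk s t)) (by omega))

theorem getVert_eq_iff (hM : IsMelonGraph M E) {i i' : Fin m} {n n' : ℕ}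
    (hn : n ≤ (E i : M.Walk s t).length) (hn' : n' ≤ (E i' : M.Walk s t).length) :
    (E i : M.Walk s t).getVert n = (E i' : M.Walk s t).getVert n' ↔
      (i = i' ∧ n = n') ∨ (n = 0 ∧ n' = 0) ∨
        (n = (E i : M.Walk s t).length ∧ n' = (E i' : M.Walk s t).length) := by
  constructor
  · intro h
    by_cases hi : i = i'
    · subst hi
      exact Or.inl ⟨rfl, (E i).isPath.getVert_injOn hn hn' h⟩
    · right
      have h2 := hM.internally_disjoint i i' hi ((E i : M.Walk s t).getVert n)
        (SimpleGraph.Walk.getVert_mem_support _ _)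
        (h ▸ SimpleGraph.Walk.getVert_mem_support _ _)
      have h3 := h ▸ h2
      rw [(E i).isPath.getVert_eq_start_iff hn, (E i).isPath.getVert_eq_end_iff hn] at h2
      rw [(E i').isPath.getVert_eq_start_iff hn', (E i').isPath.getVert_eq_end_iff hn'] at h3
      have := hM.length_pos i
      have := hM.length_pos i'
      have hst := hM.endpoints_ne
      rcases h2 with h2 | h2 <;> rcases h3 with h3 | h3
      · exact Or.inl ⟨h2, h3⟩
      · subst h2 h3
        simp [hst] at h
      · subst h2 h3
        simp [hst.symm] at h
      · exact Or.inr ⟨h2, h3⟩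
  · rintro (⟨rfl, rfl⟩ | ⟨rfl, rfl⟩ | ⟨rfl, rfl⟩) <;> simp

theorem eq_of_length_eq_one (hM : IsMelonGraph M E) {i i' : Fin m}
    (h : (E i : M.Walk s t).length = 1) (h' : (E i' : M.Walk s t).length = 1) : i = i' := by
  refine hM.paths_injective (Subtype.ext ?_)
  refine SimpleGraph.Walk.ext_getVert_le_length (h.trans h'.symm) fun k hk => ?_
  rw [hM.getVert_eq_iff hk (by omega)]
  omega

theorem exists_eq_edge (hM : IsMelonGraph M E) (e : M.edgeSet) :
    ∃ i : Fin m, ∃ n < (E i : M.Walk s t).length,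
      (e : Sym2 V) = s((E i : M.Walk s t).getVert n, (E i : M.Walk s t).getVert (n + 1)) := by
  obtain ⟨i, hi⟩ := hM.edge_mem e e.2
  refine ⟨i, ?_⟩
  rw [SimpleGraph.Walk.edges, List.mem_map] at hi
  obtain ⟨d, hd, hde⟩ := hi
  obtain ⟨n, hn, rfl⟩ := List.mem_iff_getElem.1 hd
  refine ⟨n, by simpa using hn, ?_⟩
  rw [← hde, SimpleGraph.Walk.darts_getElem_eq_getVert]
  rfl

theorem exists_isMelonLineGraph (hM : IsMelonGraph M E) :
    ∃ (p : M.edgeSet → Fin m) (j : M.edgeSet → ℕ),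
      IsMelonLineGraph M.lineGraph (fun i => (E i : M.Walk s t).length) p j := by
  choose p j hlt he using hM.exists_eq_edge
  -- An edge common to two different paths would join `s` to `t` and be the whole of both, making
  -- two paths of length one.
  have key : ∀ {i i' : Fin m} {n n' : ℕ} (_ : n < (E i : M.Walk s t).length)
      (_ : n' < (E i' : M.Walk s t).length),
      s((E i : M.Walk s t).getVert n, (E i : M.Walk s t).getVert (n + 1)) =
        s((E i' : M.Walk s t).getVert n', (E i' : M.Walk s t).getVert (n' + 1)) →
      i = i' ∧ n = n' := by
    intro i i' n n' hn hn' h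
    have h1 : i ≠ i' → ¬ ((E i : M.Walk s t).length = 1 ∧ (E i' : M.Walk s t).length = 1) :=
      fun hi h => hi (hM.eq_of_length_eq_one h.1 h.2)
    rw [Sym2.eq_iff, hM.getVert_eq_iff (by omega) (by omega),
      hM.getVert_eq_iff (by omega) (by omega), hM.getVert_eq_iff (by omega) (by omega),
      hM.getVert_eq_iff (by omega) (by omega)] at h
    by_cases hi : i = i'
    · subst hi
      omega
    · have := h1 hi
      simp only [hi, false_and, false_or] at h ⊢
      omega
  have hinj : ∀ e e', p e = p e' → j e = j e' → e = e' := by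
    intro e e' hp hj
    apply Subtype.ext
    rw [he e, he e', hp, hj]
  refine ⟨p, j, hlt, hinj, fun i n hn => ?_, fun e e' hne => ?_,
    fun i i' => hM.eq_of_length_eq_one, hM.length_pos⟩
  · let e : M.edgeSet := ⟨s((E i : M.Walk s t).getVert n, (E i : M.Walk s t).getVert (n + 1)),
      SimpleGraph.Walk.adj_getVert_succ _ hn⟩
    exact ⟨e, key (hlt e) hn (he e).symm⟩
  · have hpe := hlt e
    have hpe' := hlt e'
    have hne' : p e = p e' → j e ≠ j e' := fun h h' => hne (hinj _ _ h h')
    rw [SimpleGraph.lineGraph_adj_iff_exists, he e, he e']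
    simp only [Sym2.mem_iff, ne_eq, hne, not_false_eq_true, true_and]
    have : (∃ v, (v = (E (p e) : M.Walk s t).getVert (j e) ∨
          v = (E (p e) : M.Walk s t).getVert (j e + 1)) ∧
        (v = (E (p e') : M.Walk s t).getVert (j e') ∨
          v = (E (p e') : M.Walk s t).getVert (j e' + 1))) ↔
        (((E (p e) : M.Walk s t).getVert (j e) = (E (p e') : M.Walk s t).getVert (j e') ∨
          (E (p e) : M.Walk s t).getVert (j e) = (E (p e') : M.Walk s t).getVert (j e' + 1)) ∨
        ((E (p e) : M.Walk s t).getVert (j e + 1) = (E (p e') : M.Walk s t).getVert (j e') ∨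
          (E (p e) : M.Walk s t).getVert (j e + 1) =
            (E (p e') : M.Walk s t).getVert (j e' + 1))) := by
      simp only [or_and_right, exists_or, exists_eq_left]
    rw [this, hM.getVert_eq_iff (by omega) (by omega),
      hM.getVert_eq_iff (by omega) (by omega), hM.getVert_eq_iff (by omega) (by omega),
      hM.getVert_eq_iff (by omega) (by omega)]
    by_cases hi : p e = p e'
    · have := hne' hi
      simp only [hi, true_and]
      rw [hi] at hpe
      omega
    · simp only [hi, false_and, false_or]
      omega

end IsMelonGraph

end MelonCoordinates

/-! ### An obstruction to word-representability -/

section NotWordRepresentable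

/-- The neighbours of a vertex of a word-representable graph induce a comparability graph. -/
theorem IsWordRepresentable.exists_comparability {U : Type*} {G : SimpleGraph U}
    (hG : IsWordRepresentable G) (e : U) :
    ∃ r : U → U → Prop, (∀ x y z, r x y → r y z → r x z) ∧
      ∀ x y, G.Adj e x → G.Adj e y → x ≠ y → (G.Adj x y ↔ r x y ∨ r y x) := by
  classical
  obtain ⟨w, hw⟩ := hG
  let c : U → ℕ → ℕ := fun x n => (w.take n).count x
  let T : U → ℕ := fun x => if Leads w x e then 1 else 0
  -- `T x` is 1 when `x` runs ahead of `e`. For every neighbour `x` of `e`, the shifted count `c x -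
  -- T x` is `c e - 1` or `c e`, so two shifted counts differ by at most 1. Neighbours with equal
  -- `T` alternate exactly when their shifted counts are comparable; if the `T` differ, only one
  -- direction counts, selected by `T y ≤ T x`.
  refine ⟨fun x y => T y ≤ T x ∧ ∀ n, c x n + T y ≤ c y n + T x, ?_, ?_⟩
  · rintro x y z ⟨h1, h2⟩ ⟨h3, h4⟩
    refine ⟨h3.trans h1, fun n => ?_⟩
    have := h2 n
    have := h4 n
    omega
  · intro x y hx hy hxy
    have bound : ∀ x, G.Adj e x → T x ≤ 1 ∧ ∀ n, c x n ≤ c e n + T x ∧ c e n + T x ≤ c x n + 1 := by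
      intro x hx
      have h := (alternate_iff_leads hx.ne).1 ((hw _ _ hx.ne).1 hx)
      by_cases hT : Leads w x e
      · refine ⟨by simp [T, hT], fun n => ?_⟩
        have : c e n ≤ c x n ∧ c x n ≤ c e n + 1 := hT n
        simp only [T, hT, if_true]
        omega
      · refine ⟨by simp [T, hT], fun n => ?_⟩
        have : c x n ≤ c e n ∧ c e n ≤ c x n + 1 := h.resolve_right hT n
        simp only [T, hT, if_false]
        omega
    obtain ⟨tx, hx⟩ := bound x hx
    obtain ⟨ty, hy⟩ := bound y hy
    rw [hw x y hxy, alternate_iff_leads hxy]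
    have h1 : Leads w x y ↔ ∀ n, c y n ≤ c x n ∧ c x n ≤ c y n + 1 := Iff.rfl
    have h2 : Leads w y x ↔ ∀ n, c x n ≤ c y n ∧ c y n ≤ c x n + 1 := Iff.rfl
    rw [h1, h2]
    have h0 : ∀ x, c x 0 = 0 := fun x => by simp [c]
    rcases lt_trichotomy (T x) (T y) with h | h | h
    · constructor
      · rintro (h3 | h3)
        · exact Or.inr ⟨h.le, fun n => by have := h3 n; have := hx n; have := hy n; omega⟩
        · exact Or.inr ⟨h.le, fun n => by have := h3 n; have := hx n; have := hy n; omega⟩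
      · rintro (h3 | h3)
        · omega
        · exact Or.inr fun n => by have := h3.2 n; have := hx n; have := hy n; omega
    · constructor
      · rintro (h3 | h3)
        · exact Or.inr ⟨h.le, fun n => by have := h3 n; omega⟩
        · exact Or.inl ⟨h.ge, fun n => by have := h3 n; omega⟩
      · rintro (h3 | h3)
        · exact Or.inr fun n => by have := h3.2 n; have := hx n; have := hy n; omega
        · exact Or.inl fun n => by have := h3.2 n; have := hx n; have := hy n; omega
    · constructor
      · rintro (h3 | h3)
        · exact Or.inl ⟨h.le, fun n => by have := h3 n; have := hx n; have := hy n; omega⟩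
        · exact Or.inl ⟨h.le, fun n => by have := h3 n; have := hx n; have := hy n; omega⟩
      · rintro (h3 | h3)
        · exact Or.inl fun n => by have := h3.2 n; have := hx n; have := hy n; omega
        · omega

/-- In a comparability graph, the vertices of a triangle cannot have one private neighbour each. -/
theorem triangle_with_pendants_not_comparability {U : Type*} {G : SimpleGraph U} (r : U → U → Prop)
    (hr : ∀ x y z, r x y → r y z → r x z) (S : Set U)
    (hG : ∀ x ∈ S, ∀ y ∈ S, x ≠ y → (G.Adj x y ↔ r x y ∨ r y x))
    (a b : Fin 3 → U) (haS : ∀ i, a i ∈ S) (hbS : ∀ i, b i ∈ S)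
    (ha : ∀ i k, i ≠ k → G.Adj (a i) (a k))
    (hab : ∀ i k, G.Adj (a i) (b k) ↔ i = k) (hne : ∀ i k, a i ≠ b k) : False := by
  -- If `r (a i) (b i)`, then `r (a k) (a i)` would make `a k` adjacent to `b i`. So `a i` lies
  -- strictly below the other two, which at most one index allows. The opposite direction is
  -- symmetric, and three indices are too many.
  have step1 : ∀ i k, i ≠ k → r (a i) (b i) → r (a i) (a k) ∧ ¬ r (a k) (a i) := by
    intro i k hik h
    have h1 : ¬ r (a k) (a i) := fun h2 => hik.symm <| (hab k i).1 <|
      (hG _ (haS _) _ (hbS _) (hne _ _)).2 (Or.inl (hr _ _ _ h2 h))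
    exact ⟨((hG _ (haS _) _ (haS _) (ha i k hik).ne).1 (ha i k hik)).resolve_right h1, h1⟩
  have step2 : ∀ i k, i ≠ k → r (b i) (a i) → r (a k) (a i) ∧ ¬ r (a i) (a k) := by
    intro i k hik h
    have h1 : ¬ r (a i) (a k) := fun h2 => hik.symm <| (hab k i).1 <|
      (hG _ (haS _) _ (hbS _) (hne _ _)).2 (Or.inr (hr _ _ _ h h2))
    exact ⟨((hG _ (haS _) _ (haS _) (ha i k hik).ne).1 (ha i k hik)).resolve_left h1, h1⟩
  have h := fun i => (hG _ (haS _) _ (hbS _) (hne i i)).1 ((hab i i).2 rfl)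
  have no1 : ∀ i k, i ≠ k → r (a i) (b i) → ¬ r (a k) (b k) := fun i k hik h h' =>
    (step1 i k hik h).2 (step1 k i hik.symm h').1
  have no2 : ∀ i k, i ≠ k → r (b i) (a i) → ¬ r (b k) (a k) := fun i k hik h h' =>
    (step2 i k hik h).2 (step2 k i hik.symm h').1
  rcases h 0 with h0 | h0 <;> rcases h 1 with h1 | h1 <;> rcases h 2 with h2 | h2
  · exact no1 0 1 (by decide) h0 h1
  · exact no1 0 1 (by decide) h0 h1
  · exact no1 0 2 (by decide) h0 h2
  · exact no2 1 2 (by decide) h1 h2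
  · exact no1 1 2 (by decide) h1 h2
  · exact no2 0 2 (by decide) h0 h2
  · exact no2 0 1 (by decide) h0 h1
  · exact no2 0 1 (by decide) h0 h1

/-- All edges of paths of length two are neighbours of the single edge `e` of path `i₀`. Three such
paths give a triangle of first edges `a i`, and the last edge `b i` touches no first edge among them
but `a i`. -/
theorem IsMelonLineGraph.card_length_two_le {U ι : Type*} [Fintype ι] {G : SimpleGraph U}
    {L : ι → ℕ} {p : U → ι} {j : U → ℕ} (h : IsMelonLineGraph G L p j)
    (hG : IsWordRepresentable G) {i₀ : ι} (h₀ : L i₀ = 1) :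
    (Finset.univ.filter fun i => L i = 2).card ≤ 2 := by
  classical
  by_contra! hc
  obtain ⟨S, hS, hcard⟩ := Finset.exists_subset_card_eq hc
  let φ := (Finset.equivFinOfCardEq hcard).symm
  have hφ : ∀ i, L (φ i : ι) = 2 := fun i => (Finset.mem_filter.1 (hS (φ i).2)).2
  have hφ' : ∀ i k, (φ i : ι) = φ k ↔ i = k := fun i k => by
    rw [Subtype.coe_inj, φ.apply_eq_iff_eq]
  obtain ⟨e, he, he0⟩ := h.surj i₀ 0 (by omega)
  choose a ha ha0 using fun i => h.surj (φ i) 0 (by rw [hφ]; omega)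
  choose b hb hb1 using fun i => h.surj (φ i) 1 (by rw [hφ]; omega)
  obtain ⟨r, hr, hadj⟩ := hG.exists_comparability e
  have hne : ∀ i k, a i ≠ b k := fun i k hk => by
    have := ha0 i
    rw [hk, hb1] at this
    omega
  have hia : ∀ i k, i ≠ k → a i ≠ a k := fun i k hik hk => hik <| by
    rw [← hφ', ← ha, ← ha, hk]
  refine triangle_with_pendants_not_comparability r hr {x | G.Adj e x}
    (fun x hx y hy => hadj x y hx hy) a b (fun i => ?_) (fun i => ?_) (fun i k hik => ?_)
    (fun i k => ?_) hne
  · have : e ≠ a i := fun hk => by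
      have h1 := hφ i
      rw [← ha i, ← hk, he] at h1
      omega
    exact (h.adj _ _ this).2 (by simp [he0, ha0])
  · have : e ≠ b i := fun hk => by
      have h1 := hφ i
      rw [← hb i, ← hk, he] at h1
      omega
    exact (h.adj _ _ this).2 (by simp [he0, he, h₀, hb, hb1, hφ])
  · exact (h.adj _ _ (hia _ _ hik)).2 (by simp [ha0])
  · rw [h.adj _ _ (hne i k)]
    simp [ha, hb, ha0, hb1, hφ, hφ']

end NotWordRepresentable

/-! ### Chord diagrams and the lower bound -/

section NotTwoWordRepresentable

variable {U : Type*} {G : SimpleGraph U} {x y : U → ℕ}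

/-- The chord of `u`, with endpoints `x u < y u`, starts between the endpoints of that of `a`. -/
def StartsInside (x y : U → ℕ) (a u : U) : Prop := x a < x u ∧ x u < y a

/-- `G` is the crossing graph of the chords with endpoints `x u < y u`, `u : U`. -/
structure IsChordDiagram (G : SimpleGraph U) (x y : U → ℕ) : Prop where
  lt : ∀ u, x u < y u
  ne : ∀ u v, u ≠ v → x u ≠ x v ∧ x u ≠ y v ∧ y u ≠ y v
  adj : ∀ u v, u ≠ v → (G.Adj u v ↔
    (x u < x v ∧ x v < y u ∧ y u < y v) ∨ (x v < x u ∧ x u < y v ∧ y v < y u))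

theorem IsKWordRepresentable.exists_isChordDiagram (h : IsKWordRepresentable 2 G) :
    ∃ x y : U → ℕ, IsChordDiagram G x y := by
  obtain ⟨f, hmono, hinj, hG⟩ := h.exists_keys
  have hlt : ∀ u, f u 0 < f u 1 := fun u => hmono u (by decide)
  have hne : ∀ u v, u ≠ v → f u 0 ≠ f v 0 ∧ f u 0 ≠ f v 1 ∧ f u 1 ≠ f v 1 := fun u v huv =>
    ⟨fun h => huv (hinj _ _ _ _ h), fun h => huv (hinj _ _ _ _ h), fun h => huv (hinj _ _ _ _ h)⟩
  refine ⟨fun u => f u 0, fun u => f u 1, hlt, hne, fun u v huv => ?_⟩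
  rw [hG u v huv]
  have := hlt u
  have := hlt v
  have := hne u v huv
  simp only [KeysAlternate, Fin.forall_fin_two, Fin.exists_fin_two]
  simp
  omega

/-- A chord not crossing `a` lies on one side of it, and chords on opposite sides cannot cross. -/
theorem IsChordDiagram.startsInside_iff_of_adj (h : IsChordDiagram G x y) {a u v : U}
    (huv : G.Adj u v) (hua : ¬ G.Adj u a) (hva : ¬ G.Adj v a) (hu : u ≠ a) (hv : v ≠ a) :
    StartsInside x y a u ↔ StartsInside x y a v := by
  rw [h.adj _ _ huv.ne] at huv
  rw [h.adj _ _ hu] at hua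
  rw [h.adj _ _ hv] at hva
  have := h.lt a
  have := h.lt u
  have := h.lt v
  have := h.ne _ _ hu
  have := h.ne _ _ hv
  unfold StartsInside
  omega

/-- A chord crossing exactly one of three pairwise crossing chords `a`, `b`, `c`. -/
theorem IsChordDiagram.startsInside_of_triangle (h : IsChordDiagram G x y) {a b c : U}
    (hab : G.Adj a b) (hbc : G.Adj b c) (hac : G.Adj a c) (h1 : x a < x b) (h2 : x b < x c)
    {q : U} (ha : q ≠ a) (hb : q ≠ b) (hc : q ≠ c) :
    (G.Adj q a → ¬ G.Adj q b → ¬ G.Adj q c → (StartsInside x y b q ↔ StartsInside x y c q)) ∧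
    (¬ G.Adj q a → G.Adj q b → ¬ G.Adj q c → (StartsInside x y a q ↔ ¬ StartsInside x y c q)) ∧
    (¬ G.Adj q a → ¬ G.Adj q b → G.Adj q c → (StartsInside x y a q ↔ StartsInside x y b q)) := by
  rw [h.adj _ _ hab.ne] at hab
  rw [h.adj _ _ hbc.ne] at hbc
  rw [h.adj _ _ hac.ne] at hac
  rw [h.adj _ _ ha, h.adj _ _ hb, h.adj _ _ hc]
  have := h.lt q
  have := h.ne _ _ ha
  have := h.ne _ _ hb
  have := h.ne _ _ hc
  have e1 : x c < y a := by omega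
  have e2 : y a < y b := by omega
  have e3 : y b < y c := by omega
  clear hab hbc hac
  unfold StartsInside
  refine ⟨?_, ?_, ?_⟩ <;> intro g1 g2 g3 <;> omega

/-- The two chords `b i` with `i ≠ k` cross each other and avoid `a k`, so they share a side `s k`
of it, and the two `q i` start on that side too. With the `a k` sorted, the chords `q 0`, `q 1`, `q
2` force `s 1 = s 2`, `s 0 ≠ s 2` and `s 0 = s 1`. -/
theorem IsChordDiagram.false_of_triangles (h : IsChordDiagram G x y) (a b q : Fin 3 → U)
    (ha : ∀ i k, i ≠ k → G.Adj (a i) (a k)) (hb : ∀ i k, i ≠ k → G.Adj (b i) (b k))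
    (hqa : ∀ i k, q i ≠ a k) (hba : ∀ i k, i ≠ k → b i ≠ a k)
    (hq : ∀ i k, G.Adj (q i) (a k) ↔ i = k) (hnb : ∀ i k, i ≠ k → ¬ G.Adj (b i) (a k))
    (hqb : ∀ i k, i ≠ k → (StartsInside x y (a k) (q i) ↔ StartsInside x y (a k) (b i))) :
    False := by
  -- The hypotheses are invariant under a common permutation of the three families, so the left ends
  -- may be sorted.
  wlog hs : x (a 0) < x (a 1) ∧ x (a 1) < x (a 2) generalizing a b q
  · have hinj : ∀ i k, i ≠ k → x (a i) ≠ x (a k) := fun i k hik => (h.ne _ _ (ha i k hik).ne).1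
    have hinj' : Function.Injective (x ∘ a) := fun i k hik => by
      by_contra hne
      exact hinj i k hne hik
    let σ := Tuple.sort (x ∘ a)
    have hσ : StrictMono ((x ∘ a) ∘ σ) :=
      (Tuple.monotone_sort (x ∘ a)).strictMono_of_injective (hinj'.comp σ.injective)
    have hσ' : ∀ i k, i ≠ k → σ i ≠ σ k := fun i k hik => σ.injective.ne hik
    exact this (a ∘ σ) (b ∘ σ) (q ∘ σ) (fun i k hik => ha _ _ (hσ' i k hik))
      (fun i k hik => hb _ _ (hσ' i k hik)) (fun i k => hqa _ _)
      (fun i k hik => hba _ _ (hσ' i k hik)) (fun i k => (hq _ _).trans σ.apply_eq_iff_eq)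
      (fun i k hik => hnb _ _ (hσ' i k hik)) (fun i k hik => hqb _ _ (hσ' i k hik))
      ⟨hσ (by decide : (0 : Fin 3) < 1), hσ (by decide : (1 : Fin 3) < 2)⟩
  have T := fun i => h.startsInside_of_triangle (ha 0 1 (by decide)) (ha 1 2 (by decide))
    (ha 0 2 (by decide)) hs.1 hs.2 (hqa i 0) (hqa i 1) (hqa i 2)
  have t0 := (T 0).1 ((hq _ _).2 rfl) (by simp [hq]) (by simp [hq])
  have t1 := (T 1).2.1 (by simp [hq]) ((hq _ _).2 rfl) (by simp [hq])
  have t2 := (T 2).2.2 (by simp [hq]) (by simp [hq]) ((hq _ _).2 rfl)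
  rw [hqb _ _ (by decide), hqb _ _ (by decide)] at t0 t1 t2
  have B : ∀ i k l, i ≠ k → i ≠ l → k ≠ l →
      (StartsInside x y (a l) (b i) ↔ StartsInside x y (a l) (b k)) := fun i k l hik hil hkl =>
    h.startsInside_iff_of_adj (hb i k hik) (hnb i l hil) (hnb k l hkl) (hba i l hil) (hba k l hkl)
  have b2 := B 0 1 2 (by decide) (by decide) (by decide)
  have b1 := B 0 2 1 (by decide) (by decide) (by decide)
  have b0 := B 1 2 0 (by decide) (by decide) (by decide)
  tauto

variable {ι : Type*} [Fintype ι] {L : ι → ℕ} {p : U → ι} {j : U → ℕ}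

theorem IsMelonLineGraph.not_isKWordRepresentable_one (h : IsMelonLineGraph G L p j)
    (hc : 3 ≤ (Finset.univ.filter fun i => 2 ≤ L i).card) : ¬ IsKWordRepresentable 1 G := by
  intro hG
  obtain ⟨f, -, -, hf⟩ := hG.exists_keys
  obtain ⟨i, hi, k, hk, hik⟩ := Finset.one_lt_card.1 (lt_of_lt_of_le (by norm_num) hc)
  have hi := (Finset.mem_filter.1 hi).2
  have hk := (Finset.mem_filter.1 hk).2
  obtain ⟨u, hu, hu0⟩ := h.surj i 0 (by omega)
  obtain ⟨v, hv, hv0⟩ := h.surj k (L k - 1) (by omega)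
  have huv : u ≠ v := fun huv => hik (by rw [← hu, ← hv, huv])
  -- With a single occurrence per letter the alternation conditions are vacuous, so all vertices
  -- would be adjacent.
  have hadj : G.Adj u v := by
    rw [hf u v huv]
    constructor <;> intro a b hab <;> omega
  rw [h.adj u v huv, hu, hv, hu0, hv0] at hadj
  simp only [hik, false_and, false_or] at hadj
  omega

/-- Here `a i`, `q i`, `b i` are the first, second and last edges of three paths of length at least
two, with `q i = b i` for length two. Moving along path `i` from `q i` to `b i` never meets a
neighbour of another `a k`, so the side of `a k` is preserved. -/
theorem IsMelonLineGraph.not_isKWordRepresentable_two (h : IsMelonLineGraph G L p j)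
    (hc : 3 ≤ (Finset.univ.filter fun i => 2 ≤ L i).card) : ¬ IsKWordRepresentable 2 G := by
  classical
  intro hG
  obtain ⟨x, y, hxy⟩ := hG.exists_isChordDiagram
  obtain ⟨S, hS, hcard⟩ := Finset.exists_subset_card_eq hc
  let φ := (Finset.equivFinOfCardEq hcard).symm
  have hφ : ∀ i, 2 ≤ L (φ i) := fun i => (Finset.mem_filter.1 (hS (φ i).2)).2
  have hφ' : ∀ i k, (φ i : ι) = φ k ↔ i = k := fun i k => by
    rw [Subtype.coe_inj, φ.apply_eq_iff_eq]
  choose a ha ha0 using fun i => h.surj (φ i) 0 (by have := hφ i; omega)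
  choose q hq hq1 using fun i => h.surj (φ i) 1 (hφ i)
  choose b hb hb1 using fun i => h.surj (φ i) (L (φ i) - 1) (by have := hφ i; omega)
  have ne : ∀ u v, p u ≠ p v ∨ j u ≠ j v → u ≠ v := by
    rintro u v huv rfl
    simp at huv
  have adj' : ∀ u v i k, p u = φ i → p v = φ k → i ≠ k → (G.Adj u v ↔
      (j u = 0 ∧ j v = 0) ∨ (j u + 1 = L (φ i) ∧ j v + 1 = L (φ k))) := by
    intro u v i k hu hv hik
    have : p u ≠ p v := by rwa [hu, hv, Ne, hφ']
    rw [h.adj _ _ (ne _ _ (Or.inl this)), hu, hv, hφ']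
    simp [hik]
  have side : ∀ i k, i ≠ k → ∀ n u, p u = φ i → j u = n + 1 →
      (StartsInside x y (a k) (q i) ↔ StartsInside x y (a k) u) := by
    intro i k hik n
    have nadj : ∀ v, p v = φ i → j v ≠ 0 → ¬ G.Adj v (a k) ∧ v ≠ a k := by
      intro v hv hv0
      refine ⟨?_, ne _ _ (Or.inl (by rwa [hv, ha, Ne, hφ']))⟩
      rw [adj' _ _ i k hv (ha k) hik, ha0]
      have := hφ k
      omega
    induction n with
    | zero =>
      intro u hu hu1
      rw [h.inj u (q i) (by rw [hu, hq]) (by rw [hu1, hq1])]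
    | succ n ih =>
      intro u hu hun
      obtain ⟨v, hv, hvn⟩ := h.surj (φ i) (n + 1) (by have := h.lt u; rw [hu] at this; omega)
      rw [ih v hv hvn]
      have hvu : v ≠ u := ne _ _ (Or.inr (by omega))
      refine hxy.startsInside_iff_of_adj ((h.adj _ _ hvu).2 (Or.inl ⟨by rw [hu, hv], by omega⟩))
        (nadj v hv (by omega)).1 (nadj u hu (by omega)).1
        (nadj v hv (by omega)).2 (nadj u hu (by omega)).2
  refine hxy.false_of_triangles a b q ?_ ?_ ?_ ?_ ?_ ?_ ?_
  · intro i k hik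
    exact (adj' _ _ i k (ha i) (ha k) hik).2 (Or.inl ⟨ha0 i, ha0 k⟩)
  · intro i k hik
    have := hφ i
    have := hφ k
    exact (adj' _ _ i k (hb i) (hb k) hik).2 (Or.inr ⟨by rw [hb1]; omega, by rw [hb1]; omega⟩)
  · intro i k
    exact ne _ _ (Or.inr (by rw [hq1, ha0]; omega))
  · intro i k hik
    exact ne _ _ (Or.inl (by rwa [hb, ha, Ne, hφ']))
  · intro i k
    by_cases hik : i = k
    · subst hik
      rw [h.adj _ _ (ne _ _ (Or.inr (by rw [hq1, ha0]; omega)))]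
      simp [hq, ha, hq1, ha0]
    · rw [adj' _ _ i k (hq i) (ha k) hik, hq1, ha0]
      have := hφ k
      simp only [hik, iff_false]
      omega
  · intro i k hik
    rw [adj' _ _ i k (hb i) (ha k) hik, hb1, ha0]
    have := hφ k
    have := hφ i
    omega
  · intro i k hik
    exact side i k hik (L (φ i) - 2) (b i) (hb i) (by rw [hb1]; have := hφ i; omega)

end NotTwoWordRepresentable

/-! ### A 3-uniform word when no path has length one -/

section Constructions

/-- Occurrence times, ordered by block, then by the path in the block, then inside the path. -/
def blockKey (b i q : ℕ) : ℕ ×ₗ ℕ ×ₗ ℕ := toLex (b, toLex (i, q))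

theorem blockKey_lt {b i q b' i' q' : ℕ} : blockKey b i q < blockKey b' i' q' ↔
    b < b' ∨ b = b' ∧ (i < i' ∨ i = i' ∧ q < q') := by
  simp [blockKey, Prod.Lex.toLex_lt_toLex]

theorem blockKey_inj {b i q b' i' q' : ℕ} : blockKey b i q = blockKey b' i' q' ↔
    b = b' ∧ i = i' ∧ q = q' := by
  simp [blockKey]

variable {U : Type*} [Finite U] {G : SimpleGraph U}

theorem isKWordRepresentable_two_of_keys {α : Type*} [LinearOrder α] (x y : U → α)
    (hxy : ∀ u, x u < y u)
    (hinj : ∀ u v, u ≠ v → x u ≠ x v ∧ x u ≠ y v ∧ y u ≠ y v)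
    (hG : ∀ u v, u ≠ v → (G.Adj u v ↔ ((x u < x v ∧ x v < y u) ∨ (x u < y v ∧ y v < y u)) ∧
      ((x v < x u ∧ x u < y v) ∨ (x v < y u ∧ y u < y v)))) :
    IsKWordRepresentable 2 G := by
  refine isKWordRepresentable_of_keys (fun u => ![x u, y u]) (fun u => ?_) (fun u v i k => ?_)
    (fun u v huv => ?_)
  · rw [Fin.strictMono_iff_lt_succ]
    simpa using hxy u
  · contrapose
    intro huv
    have h1 := hinj u v huv
    have h2 := hinj v u (Ne.symm huv)
    revert i k
    simp [Fin.forall_fin_two, h1, h2.2.1.symm]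
  · rw [hG u v huv]
    simp [KeysAlternate, Fin.forall_fin_two, Fin.exists_fin_two]

theorem isKWordRepresentable_three_of_keys {α : Type*} [LinearOrder α] (x y z : U → α)
    (hxy : ∀ u, x u < y u) (hyz : ∀ u, y u < z u)
    (hinj : ∀ u v, u ≠ v →
      x u ≠ x v ∧ x u ≠ y v ∧ x u ≠ z v ∧ y u ≠ y v ∧ y u ≠ z v ∧ z u ≠ z v)
    (hG : ∀ u v, u ≠ v → (G.Adj u v ↔
      ((x u < x v ∧ x v < y u) ∨ (x u < y v ∧ y v < y u) ∨ (x u < z v ∧ z v < y u)) ∧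
      ((y u < x v ∧ x v < z u) ∨ (y u < y v ∧ y v < z u) ∨ (y u < z v ∧ z v < z u)) ∧
      ((x v < x u ∧ x u < y v) ∨ (x v < y u ∧ y u < y v) ∨ (x v < z u ∧ z u < y v)) ∧
      ((y v < x u ∧ x u < z v) ∨ (y v < y u ∧ y u < z v) ∨ (y v < z u ∧ z u < z v)))) :
    IsKWordRepresentable 3 G := by
  refine isKWordRepresentable_of_keys (fun u => ![x u, y u, z u]) (fun u => ?_)
    (fun u v i k => ?_) (fun u v huv => ?_)
  · rw [Fin.strictMono_iff_lt_succ]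
    simpa [Fin.forall_fin_two] using ⟨hxy u, hyz u⟩
  · contrapose
    intro huv
    have h1 := hinj u v huv
    have h2 := hinj v u (Ne.symm huv)
    revert i k
    simp [Fin.forall_fin_succ, h1, h2.2.1.symm, h2.2.2.1.symm, h2.2.2.2.2.1.symm]
  -- Consecutive occurrences suffice: what separates the first two also separates the first from the
  -- third.
  · have key : KeysAlternate (fun u => ![x u, y u, z u]) u v ↔
      (∃ l, x u < ![x v, y v, z v] l ∧ ![x v, y v, z v] l < y u) ∧
      (∃ l, y u < ![x v, y v, z v] l ∧ ![x v, y v, z v] l < z u) ∧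
      (∃ l, x v < ![x u, y u, z u] l ∧ ![x u, y u, z u] l < y v) ∧
      (∃ l, y v < ![x u, y u, z u] l ∧ ![x u, y u, z u] l < z v) := by
      constructor
      · rintro ⟨h1, h2⟩
        exact ⟨h1 0 1 (by decide), h1 1 2 (by decide), h2 0 1 (by decide), h2 1 2 (by decide)⟩
      · rintro ⟨⟨l1, h1⟩, ⟨l2, h2⟩, ⟨l3, h3⟩, ⟨l4, h4⟩⟩
        constructor
        · intro i k hik
          fin_cases i <;> fin_cases k <;> simp at hik
          · exact ⟨l1, h1⟩
          · exact ⟨l1, h1.1, h1.2.trans (hyz u)⟩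
          · exact ⟨l2, h2⟩
        · intro i k hik
          fin_cases i <;> fin_cases k <;> simp at hik
          · exact ⟨l3, h3⟩
          · exact ⟨l3, h3.1, h3.2.trans (hyz v)⟩
          · exact ⟨l4, h4⟩
    rw [hG u v huv, key]
    simp [Fin.exists_fin_succ]

variable {m : ℕ} {L : Fin m → ℕ} {p : U → Fin m} {j : U → ℕ}

/-- With `u₀, …, u_ℓ` the vertices of a path, the word is
`∏ (u₁u₀ u₂u₁ ⋯ u_ℓ u_{ℓ-1}) · ∏ u_ℓ · ∏ (u₀u₁⋯u_ℓ) · ∏ u₀`, the products running over all paths. -/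
theorem IsMelonLineGraph.isKWordRepresentable_three_of_two_le (h : IsMelonLineGraph G L p j)
    (hL : ∀ i, 2 ≤ L i) : IsKWordRepresentable 3 G := by
  -- In block 0, `u_j` has slots `2j - 2` and `2j + 1`; `u₀` keeps only the second and `u_ℓ` only
  -- the first. An inner vertex thus occurs twice within the stretch of its own path and alternates
  -- with nothing outside it. The `u₀` of all paths appear in the same path order in blocks 0, 2, 3,
  -- and the `u_ℓ` in blocks 0, 1, 2. For different paths, `u₀` and `v_ℓ` fail to alternate: `v_ℓ`
  -- is repeated without `u₀` from block 0 to 1 or from block 1 to 2, depending on the order of the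
  -- paths.
  let x : U → ℕ ×ₗ ℕ ×ₗ ℕ := fun u =>
    if j u = 0 then blockKey 0 (p u) 1 else blockKey 0 (p u) (2 * j u - 2)
  let y : U → ℕ ×ₗ ℕ ×ₗ ℕ := fun u =>
    if j u = 0 then blockKey 2 (p u) 0 else if j u + 1 = L (p u) then blockKey 1 (p u) 0
      else blockKey 0 (p u) (2 * j u + 1)
  let z : U → ℕ ×ₗ ℕ ×ₗ ℕ := fun u =>
    if j u = 0 then blockKey 3 (p u) 0 else blockKey 2 (p u) (j u)
  have cases : ∀ u, (j u = 0 ∧ j u + 1 ≠ L (p u)) ∨ (j u ≠ 0 ∧ j u + 1 = L (p u)) ∨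
      (j u ≠ 0 ∧ j u + 1 ≠ L (p u)) := fun u => by
    have := hL (p u)
    omega
  refine isKWordRepresentable_three_of_keys x y z (fun u => ?_) (fun u => ?_)
    (fun u v huv => ?_) (fun u v huv => ?_)
  · rcases cases u with ⟨h1, h2⟩ | ⟨h1, h2⟩ | ⟨h1, h2⟩ <;> simp [x, y, h1, h2, blockKey_lt]
  · rcases cases u with ⟨h1, h2⟩ | ⟨h1, h2⟩ | ⟨h1, h2⟩ <;> simp [y, z, h1, h2, blockKey_lt]
  · have hne : (p u : ℕ) = p v → j u ≠ j v := fun h1 h2 => huv (h.inj u v (Fin.ext h1) h2)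
    have e1 := h.lt u
    have e2 := h.lt v
    have hLe : (p u : ℕ) = p v → L (p u) = L (p v) := fun h1 => by rw [Fin.ext h1]
    rcases cases u with ⟨h1, h2⟩ | ⟨h1, h2⟩ | ⟨h1, h2⟩ <;>
    rcases cases v with ⟨h3, h4⟩ | ⟨h3, h4⟩ | ⟨h3, h4⟩ <;>
    simp [x, y, z, h1, h2, h3, h4, blockKey_inj] <;> omega
  · have hne : (p u : ℕ) = p v → j u ≠ j v := fun h1 h2 => huv (h.inj u v (Fin.ext h1) h2)
    have e1 := h.lt u
    have e2 := h.lt v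
    have hLe : (p u : ℕ) = p v → L (p u) = L (p v) := fun h1 => by rw [Fin.ext h1]
    rw [h.adj u v huv, ← Fin.val_inj]
    rcases lt_trichotomy (p u : ℕ) (p v) with hp | hp | hp
    · rcases cases u with ⟨h1, h2⟩ | ⟨h1, h2⟩ | ⟨h1, h2⟩ <;>
      rcases cases v with ⟨h3, h4⟩ | ⟨h3, h4⟩ | ⟨h3, h4⟩ <;>
      simp [x, y, z, h1, h2, h3, h4, hp, hp.ne, hp.ne', hp.not_gt, blockKey_lt] <;> omega
    · rcases cases u with ⟨h1, h2⟩ | ⟨h1, h2⟩ | ⟨h1, h2⟩ <;>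
      rcases cases v with ⟨h3, h4⟩ | ⟨h3, h4⟩ | ⟨h3, h4⟩ <;>
      simp [x, y, z, h1, h2, h3, h4, hp, blockKey_lt] <;> omega
    · rcases cases u with ⟨h1, h2⟩ | ⟨h1, h2⟩ | ⟨h1, h2⟩ <;>
      rcases cases v with ⟨h3, h4⟩ | ⟨h3, h4⟩ | ⟨h3, h4⟩ <;>
      simp [x, y, z, h1, h2, h3, h4, hp, hp.ne, hp.ne', hp.not_gt, blockKey_lt] <;> omega

end Constructions

/-! ### A 2-uniform word for at most two paths of length at least two -/

section Constructions

variable {U : Type*} [Finite U] {G : SimpleGraph U}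

/-- The labels assign the at most two exceptional paths to the two asymmetric roles in the explicit
words. -/
theorem exists_labelling_of_card_le_two {ι : Type*} [Fintype ι] (P : ι → Prop) [DecidablePred P]
    (h : (Finset.univ.filter P).card ≤ 2) : ∃ c : ι → ℕ, (∀ i, P i → c i = 1 ∨ c i = 2) ∧
      ∀ i i', P i → P i' → c i = c i' → i = i' := by
  let φ := (Finset.univ.filter P).equivFin
  have hmem : ∀ i, P i → i ∈ Finset.univ.filter P := fun i hi => by simpa using hi
  refine ⟨fun i => if hi : P i then φ ⟨i, hmem i hi⟩ + 1 else 0, fun i hi => ?_,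
    fun i i' hi hi' hc => ?_⟩
  · have := (φ ⟨i, hmem i hi⟩).2
    simp only [hi, dif_pos]
    omega
  · simp only [hi, hi', dif_pos, add_left_inj, Fin.val_inj, φ.apply_eq_iff_eq] at hc
    exact congrArg Subtype.val hc

variable {m : ℕ} {L : Fin m → ℕ} {p : U → Fin m} {j : U → ℕ}

set_option maxHeartbeats 4000000 in
/-- With `u₀, …, u_k` and `v₀, …, v_l` the vertices of the two longer paths and `e` the path of
length one, the word is
`e v₀ (u₁u₀ u₂u₁ ⋯ u_k u_{k-1}) v_l e u_k (v_{l-1} v_l ⋯ v₁v₂ v₀v₁) u₀`. -/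
theorem IsMelonLineGraph.isKWordRepresentable_two (h : IsMelonLineGraph G L p j)
    (hc : (Finset.univ.filter fun i => 2 ≤ L i).card ≤ 2) : IsKWordRepresentable 2 G := by
  obtain ⟨c, hc12, hcinj⟩ := exists_labelling_of_card_le_two _ hc
  -- Label 1 marks the path `u`, label 2 the path `v`. Exactly the end edges occur once between the
  -- two `e`. The chords of `u₀` and `v₀` cross, as do those of `u_k` and `v_l`, while `v_l` is
  -- nested in `u₀` and `u_k` in `v₀`. The second stretch runs backwards along `v`, hence the slots
  -- counted from `L (p u)`.
  let x : U → ℕ ×ₗ ℕ ×ₗ ℕ := fun u =>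
    if L (p u) = 1 then blockKey 0 0 0
    else if c (p u) = 1 then if j u = 0 then blockKey 2 0 1 else blockKey 2 0 (2 * j u - 2)
    else if j u = 0 then blockKey 1 0 0
    else if j u + 1 = L (p u) then blockKey 3 0 0
    else blockKey 6 0 (2 * (L (p u) - 2 - j u))
  let y : U → ℕ ×ₗ ℕ ×ₗ ℕ := fun u =>
    if L (p u) = 1 then blockKey 4 0 0
    else if c (p u) = 1 then
      if j u = 0 then blockKey 7 0 0
      else if j u + 1 = L (p u) then blockKey 5 0 0 else blockKey 2 0 (2 * j u + 1)
    else if j u = 0 then blockKey 6 0 (2 * (L (p u) - 2))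
    else blockKey 6 0 (2 * (L (p u) - 1 - j u) + 1)
  have cases : ∀ u,
      (L (p u) = 1 ∧ j u = 0 ∧ x u = blockKey 0 0 0 ∧ y u = blockKey 4 0 0) ∨
      (2 ≤ L (p u) ∧ c (p u) = 1 ∧ j u = 0 ∧ x u = blockKey 2 0 1 ∧ y u = blockKey 7 0 0) ∨
      (2 ≤ L (p u) ∧ c (p u) = 1 ∧ j u + 1 = L (p u) ∧ x u = blockKey 2 0 (2 * j u - 2) ∧
        y u = blockKey 5 0 0) ∨
      (2 ≤ L (p u) ∧ c (p u) = 1 ∧ (j u ≠ 0 ∧ j u + 1 ≠ L (p u)) ∧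
        x u = blockKey 2 0 (2 * j u - 2) ∧ y u = blockKey 2 0 (2 * j u + 1)) ∨
      (2 ≤ L (p u) ∧ c (p u) = 2 ∧ j u = 0 ∧ x u = blockKey 1 0 0 ∧
        y u = blockKey 6 0 (2 * (L (p u) - 2))) ∨
      (2 ≤ L (p u) ∧ c (p u) = 2 ∧ j u + 1 = L (p u) ∧ x u = blockKey 3 0 0 ∧
        y u = blockKey 6 0 1) ∨
      (2 ≤ L (p u) ∧ c (p u) = 2 ∧ (j u ≠ 0 ∧ j u + 1 ≠ L (p u)) ∧
        x u = blockKey 6 0 (2 * (L (p u) - 2 - j u)) ∧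
        y u = blockKey 6 0 (2 * (L (p u) - 1 - j u) + 1)) := by
    intro u
    have hlt := h.lt u
    have hcu := hc12 (p u)
    rcases Nat.lt_or_ge 1 (L (p u)) with h1 | h1
    · have hL1 : L (p u) ≠ 1 := by omega
      rcases hcu (by omega) with hcu | hcu <;> by_cases hj : j u = 0 <;>
        by_cases hj' : j u + 1 = L (p u)
      all_goals simp [x, y, hL1, hcu, hj, hj']
      all_goals try omega
    · have := h.pos (p u)
      have hL1 : L (p u) = 1 := by omega
      simp [x, y, hL1]
      omega
  refine isKWordRepresentable_two_of_keys x y (fun u => ?_) (fun u v huv => ?_) (fun u v huv => ?_)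
  · have hlt := h.lt u
    rcases cases u with ⟨a1, a3, hx, hy⟩ | ⟨a1, a2, a3, hx, hy⟩ | ⟨a1, a2, a3, hx, hy⟩ |
      ⟨a1, a2, a3, hx, hy⟩ | ⟨a1, a2, a3, hx, hy⟩ | ⟨a1, a2, a3, hx, hy⟩ | ⟨a1, a2, a3, hx, hy⟩ <;>
    rw [hx, hy] <;> simp [blockKey_lt] <;> omega
  all_goals
    have hlt := h.lt u
    have hlt' := h.lt v
    have hp : (p u = p v ∧ j u ≠ j v ∧ L (p u) = L (p v) ∧ c (p u) = c (p v)) ∨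
        (p u ≠ p v ∧ (L (p u) ≠ 1 ∨ L (p v) ≠ 1) ∧
          (L (p u) = 1 ∨ L (p v) = 1 ∨ c (p u) ≠ c (p v))) := by
      by_cases hp : p u = p v
      · exact Or.inl ⟨hp, fun h2 => huv (h.inj u v hp h2), by rw [hp], by rw [hp]⟩
      · refine Or.inr ⟨hp, ?_, ?_⟩
        · by_contra! h1
          exact hp (h.eq_of_one _ _ h1.1 h1.2)
        · by_contra! h1
          have := h.pos (p u)
          have := h.pos (p v)
          exact hp (hcinj _ _ (by omega) (by omega) h1.2.2)
  · rcases hp with ⟨hp, hj, hL, hcc⟩ | ⟨hp, hj, hcc⟩ <;>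
    rcases cases u with ⟨a1, a3, hx, hy⟩ | ⟨a1, a2, a3, hx, hy⟩ | ⟨a1, a2, a3, hx, hy⟩ |
      ⟨a1, a2, a3, hx, hy⟩ | ⟨a1, a2, a3, hx, hy⟩ | ⟨a1, a2, a3, hx, hy⟩ | ⟨a1, a2, a3, hx, hy⟩ <;>
    rcases cases v with ⟨b1, b3, hx', hy'⟩ | ⟨b1, b2, b3, hx', hy'⟩ | ⟨b1, b2, b3, hx', hy'⟩ |
      ⟨b1, b2, b3, hx', hy'⟩ | ⟨b1, b2, b3, hx', hy'⟩ | ⟨b1, b2, b3, hx', hy'⟩ |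
      ⟨b1, b2, b3, hx', hy'⟩ <;>
    first
    | omega
    | (rw [hx, hy, hx', hy']; simp [blockKey_inj]; done)
    | (rw [hx, hy, hx', hy']; simp [blockKey_inj]; omega)
  · rw [h.adj u v huv]
    rcases hp with ⟨hp, hj, hL, hcc⟩ | ⟨hp, hj, hcc⟩ <;>
    rcases cases u with ⟨a1, a3, hx, hy⟩ | ⟨a1, a2, a3, hx, hy⟩ | ⟨a1, a2, a3, hx, hy⟩ |
      ⟨a1, a2, a3, hx, hy⟩ | ⟨a1, a2, a3, hx, hy⟩ | ⟨a1, a2, a3, hx, hy⟩ | ⟨a1, a2, a3, hx, hy⟩ <;>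
    rcases cases v with ⟨b1, b3, hx', hy'⟩ | ⟨b1, b2, b3, hx', hy'⟩ | ⟨b1, b2, b3, hx', hy'⟩ |
      ⟨b1, b2, b3, hx', hy'⟩ | ⟨b1, b2, b3, hx', hy'⟩ | ⟨b1, b2, b3, hx', hy'⟩ |
      ⟨b1, b2, b3, hx', hy'⟩ <;>
    first
    | omega
    | (rw [hx, hy, hx', hy']; simp [hp, blockKey_lt]; done)
    | (rw [hx, hy, hx', hy']; simp [hp, blockKey_lt]; omega)

end Constructions

/-! ### A 3-uniform word in the presence of a path of length one -/

section Constructions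

variable {U : Type*} [Finite U] {G : SimpleGraph U}
variable {m : ℕ} {L : Fin m → ℕ} {p : U → Fin m} {j : U → ℕ}

set_option maxHeartbeats 4000000 in
/-- With `e` the path of length one, `b₁a₁` and `b₂a₂` the paths of length two, and `u₀, …, u_ℓ` the
vertices of a longer path, the word is
`a₁ b₂ ∏ (u₁u₀ ⋯ u_ℓ u_{ℓ-1}) b₁ a₂ · e · a₁ ∏ u_ℓ b₂ a₂ ∏ u₀ b₁ · ∏ (u₁⋯u_{ℓ-1}) · e ·
b₂ ∏ u₀ a₁ b₁ ∏ u_ℓ a₂ · e`, the products running over all longer paths. -/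
theorem IsMelonLineGraph.isKWordRepresentable_three_of_card_le (h : IsMelonLineGraph G L p j)
    (hc : (Finset.univ.filter fun i => L i = 2).card ≤ 2) : IsKWordRepresentable 3 G := by
  obtain ⟨c, hc12, hcinj⟩ := exists_labelling_of_card_le_two _ hc
  -- Each `e` closes a segment containing every end edge once, so two end edges alternate exactly
  -- when all three segments show them in the same order. Last edges always come as `a₁, u_ℓ, a₂`
  -- and first edges as `b₂, u₀, b₁`; also `a₁` stays before `b₁` and `b₂` before `a₂`. Any other
  -- first and last edge swap order in some segment. Inner edges occur twice before the first `e`,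
  -- within the stretch of their own path.
  let x : U → ℕ ×ₗ ℕ ×ₗ ℕ := fun u =>
    if L (p u) = 1 then blockKey 5 0 0
    else if L (p u) = 2 then
      if c (p u) = 1 then if j u = 0 then blockKey 3 0 0 else blockKey 0 0 0
      else if j u = 0 then blockKey 1 0 0 else blockKey 4 0 0
    else if j u = 0 then blockKey 2 (p u) 1
    else if j u + 1 = L (p u) then blockKey 2 (p u) (2 * j u - 2)
    else blockKey 2 (p u) (2 * j u - 2)
  let y : U → ℕ ×ₗ ℕ ×ₗ ℕ := fun u =>
    if L (p u) = 1 then blockKey 13 0 0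
    else if L (p u) = 2 then
      if c (p u) = 1 then if j u = 0 then blockKey 11 0 0 else blockKey 6 0 0
      else if j u = 0 then blockKey 8 0 0 else blockKey 9 0 0
    else if j u = 0 then blockKey 10 (p u) 0
    else if j u + 1 = L (p u) then blockKey 7 (p u) 0
    else blockKey 2 (p u) (2 * j u + 1)
  let z : U → ℕ ×ₗ ℕ ×ₗ ℕ := fun u =>
    if L (p u) = 1 then blockKey 20 0 0
    else if L (p u) = 2 then
      if c (p u) = 1 then if j u = 0 then blockKey 17 0 0 else blockKey 16 0 0
      else if j u = 0 then blockKey 14 0 0 else blockKey 19 0 0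
    else if j u = 0 then blockKey 15 (p u) 0
    else if j u + 1 = L (p u) then blockKey 18 (p u) 0
    else blockKey 12 (p u) (j u)
  have cases : ∀ u,
      ((L (p u) = 1) ∧ j u = 0 ∧
        x u = blockKey 5 0 0 ∧ y u = blockKey 13 0 0 ∧ z u = blockKey 20 0 0) ∨
      ((L (p u) = 2 ∧ c (p u) = 1) ∧ j u = 1 ∧
        x u = blockKey 0 0 0 ∧ y u = blockKey 6 0 0 ∧ z u = blockKey 16 0 0) ∨
      ((L (p u) = 2 ∧ c (p u) = 1) ∧ j u = 0 ∧
        x u = blockKey 3 0 0 ∧ y u = blockKey 11 0 0 ∧ z u = blockKey 17 0 0) ∨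
      ((L (p u) = 2 ∧ c (p u) = 2) ∧ j u = 1 ∧
        x u = blockKey 4 0 0 ∧ y u = blockKey 9 0 0 ∧ z u = blockKey 19 0 0) ∨
      ((L (p u) = 2 ∧ c (p u) = 2) ∧ j u = 0 ∧
        x u = blockKey 1 0 0 ∧ y u = blockKey 8 0 0 ∧ z u = blockKey 14 0 0) ∨
      ((3 ≤ L (p u)) ∧ j u + 1 = L (p u) ∧
        x u = blockKey 2 (p u) (2 * j u - 2) ∧ y u = blockKey 7 (p u) 0 ∧
        z u = blockKey 18 (p u) 0) ∨
      ((3 ≤ L (p u)) ∧ j u = 0 ∧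
        x u = blockKey 2 (p u) 1 ∧ y u = blockKey 10 (p u) 0 ∧ z u = blockKey 15 (p u) 0) ∨
      ((3 ≤ L (p u)) ∧ (j u ≠ 0 ∧ j u + 1 ≠ L (p u)) ∧
        x u = blockKey 2 (p u) (2 * j u - 2) ∧ y u = blockKey 2 (p u) (2 * j u + 1) ∧
        z u = blockKey 12 (p u) (j u)) := by
    intro u
    have hlt := h.lt u
    have hcu := hc12 (p u)
    rcases Nat.lt_or_ge 1 (L (p u)) with h1 | h1
    · have hL1 : L (p u) ≠ 1 := by omega
      by_cases hL2 : L (p u) = 2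
      · rcases hcu hL2 with hcu | hcu <;> by_cases hj : j u = 0
        all_goals simp [x, y, z, hL2, hcu, hj]
        all_goals omega
      · by_cases hj : j u = 0 <;> by_cases hj' : j u + 1 = L (p u)
        all_goals simp [x, y, z, hL1, hL2, hj, hj']
        all_goals try omega
    · have := h.pos (p u)
      have hL1 : L (p u) = 1 := by omega
      simp [x, y, z, hL1]
      omega
  refine isKWordRepresentable_three_of_keys x y z (fun u => ?_) (fun u => ?_)
    (fun u v huv => ?_) (fun u v huv => ?_)
  iterate 2
    · rcases cases u with ⟨a1, a2, hx, hy, hz⟩ | ⟨a1, a2, hx, hy, hz⟩ | ⟨a1, a2, hx, hy, hz⟩ |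
      ⟨a1, a2, hx, hy, hz⟩ | ⟨a1, a2, hx, hy, hz⟩ | ⟨a1, a2, hx, hy, hz⟩ |
      ⟨a1, a2, hx, hy, hz⟩ | ⟨a1, a2, hx, hy, hz⟩ <;>
      simp [hx, hy, hz, blockKey_lt]
  all_goals
    have hlt := h.lt u
    have hlt' := h.lt v
    have hp : ((p u : ℕ) = p v ∧ j u ≠ j v ∧ L (p u) = L (p v) ∧ c (p u) = c (p v)) ∨
        ((p u : ℕ) < p v ∧ (L (p u) ≠ 1 ∨ L (p v) ≠ 1) ∧
          (L (p u) ≠ 2 ∨ L (p v) ≠ 2 ∨ c (p u) ≠ c (p v))) ∨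
        ((p v : ℕ) < p u ∧ (L (p u) ≠ 1 ∨ L (p v) ≠ 1) ∧
          (L (p u) ≠ 2 ∨ L (p v) ≠ 2 ∨ c (p u) ≠ c (p v))) := by
      by_cases hp : p u = p v
      · exact Or.inl ⟨by rw [hp], fun h2 => huv (h.inj u v hp h2), by rw [hp], by rw [hp]⟩
      · have h3 : L (p u) ≠ 1 ∨ L (p v) ≠ 1 := by
          by_contra! h1
          exact hp (h.eq_of_one _ _ h1.1 h1.2)
        have h4 : L (p u) ≠ 2 ∨ L (p v) ≠ 2 ∨ c (p u) ≠ c (p v) := by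
          by_contra! h1
          exact hp (hcinj _ _ h1.1 h1.2.1 h1.2.2)
        have h5 : (p u : ℕ) ≠ p v := Fin.val_ne_of_ne hp
        rcases Nat.lt_or_gt_of_ne h5 with h5 | h5
        · exact Or.inr (Or.inl ⟨h5, h3, h4⟩)
        · exact Or.inr (Or.inr ⟨h5, h3, h4⟩)
  · rcases hp with ⟨hp, hj, hL⟩ | ⟨hp, hj, hcc⟩ | ⟨hp, hj, hcc⟩ <;>
    rcases cases u with ⟨a1, a2, hx, hy, hz⟩ | ⟨a1, a2, hx, hy, hz⟩ | ⟨a1, a2, hx, hy, hz⟩ |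
      ⟨a1, a2, hx, hy, hz⟩ | ⟨a1, a2, hx, hy, hz⟩ | ⟨a1, a2, hx, hy, hz⟩ |
      ⟨a1, a2, hx, hy, hz⟩ | ⟨a1, a2, hx, hy, hz⟩ <;>
    rcases cases v with ⟨b1, b2, hx', hy', hz'⟩ | ⟨b1, b2, hx', hy', hz'⟩ |
      ⟨b1, b2, hx', hy', hz'⟩ | ⟨b1, b2, hx', hy', hz'⟩ | ⟨b1, b2, hx', hy', hz'⟩ |
      ⟨b1, b2, hx', hy', hz'⟩ | ⟨b1, b2, hx', hy', hz'⟩ | ⟨b1, b2, hx', hy', hz'⟩ <;>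
    first
    | omega
    | (rw [hx, hy, hz, hx', hy', hz']; simp [blockKey_inj]; done)
    | (rw [hx, hy, hz, hx', hy', hz']; simp [blockKey_inj]; omega)
  · rw [h.adj u v huv, ← Fin.val_inj]
    rcases hp with ⟨hp, hj, hL⟩ | ⟨hp, hj, hcc⟩ | ⟨hp, hj, hcc⟩ <;>
    rcases cases u with ⟨a1, a2, hx, hy, hz⟩ | ⟨a1, a2, hx, hy, hz⟩ | ⟨a1, a2, hx, hy, hz⟩ |
      ⟨a1, a2, hx, hy, hz⟩ | ⟨a1, a2, hx, hy, hz⟩ | ⟨a1, a2, hx, hy, hz⟩ |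
      ⟨a1, a2, hx, hy, hz⟩ | ⟨a1, a2, hx, hy, hz⟩ <;>
    rcases cases v with ⟨b1, b2, hx', hy', hz'⟩ | ⟨b1, b2, hx', hy', hz'⟩ |
      ⟨b1, b2, hx', hy', hz'⟩ | ⟨b1, b2, hx', hy', hz'⟩ | ⟨b1, b2, hx', hy', hz'⟩ |
      ⟨b1, b2, hx', hy', hz'⟩ | ⟨b1, b2, hx', hy', hz'⟩ | ⟨b1, b2, hx', hy', hz'⟩ <;>
    first
    | omega
    | (rw [hx, hy, hz, hx', hy', hz']; simp [hp, blockKey_lt]; done)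
    | (rw [hx, hy, hz, hx', hy', hz']; simp [hp, blockKey_lt]; omega)

end Constructions

/-! ### The representation number -/

theorem representationNumber_le {V : Type*} {G : SimpleGraph V} {k : ℕ} (hk : 1 ≤ k)
    (h : IsKWordRepresentable k G) : representationNumber G ≤ k :=
  iInf₂_le k ⟨hk, h⟩

theorem le_representationNumber {V : Type*} {G : SimpleGraph V} {k : ℕ}
    (h : ∀ l, 1 ≤ l → l < k → ¬ IsKWordRepresentable l G) : k ≤ representationNumber G := by
  refine le_iInf₂ fun l hl => ?_
  by_contra! hlt
  exact h l hl.1 (by exact_mod_cast hlt) hl.2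

theorem IsMelonGraph.finite_edgeSet {V : Type*} {M : SimpleGraph V} {m : ℕ} {s t : V}
    {E : Fin m → M.Path s t} (hM : IsMelonGraph M E) : Finite M.edgeSet := by
  have : M.edgeSet ⊆ ⋃ i : Fin m, {e | e ∈ (E i : M.Walk s t).edges} := fun e he =>
    Set.mem_iUnion.2 (hM.edge_mem e he)
  exact (Set.finite_iUnion fun i => List.finite_toSet _).subset this

/-- Word-representability matters only if some path has length one, where it bounds the number of
paths of length two. -/
theorem IsMelonLineGraph.isKWordRepresentable_three {U : Type*} [Finite U] {G : SimpleGraph U}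
    {m : ℕ} {L : Fin m → ℕ} {p : U → Fin m} {j : U → ℕ} (h : IsMelonLineGraph G L p j)
    (hG : IsWordRepresentable G) : IsKWordRepresentable 3 G := by
  by_cases h1 : ∃ i, L i = 1
  · obtain ⟨i, hi⟩ := h1
    exact h.isKWordRepresentable_three_of_card_le (h.card_length_two_le hG hi)
  · push Not at h1
    exact h.isKWordRepresentable_three_of_two_le fun i => by
      have := h.pos i
      have := h1 i
      omega

theorem theorem4p6 {V : Type*} (M : SimpleGraph V) {m : ℕ} {s t : V}
    (E : Fin m → M.Path s t) (hM : IsMelonGraph M E)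
    (hL : IsWordRepresentable M.lineGraph) :
    representationNumber M.lineGraph ≤ 3 ∧
      (representationNumber M.lineGraph = 3 ↔
        3 ≤ (Finset.univ.filter fun i : Fin m => 2 ≤ (E i : M.Walk s t).length).card) := by
  have := hM.finite_edgeSet
  obtain ⟨p, j, h⟩ := hM.exists_isMelonLineGraph
  have h3 := representationNumber_le (k := 3) (by norm_num) (h.isKWordRepresentable_three hL)
  refine ⟨h3, fun heq => ?_, fun hc => le_antisymm h3
    (le_representationNumber (k := 3) fun l hl hl' => ?_)⟩
  · by_contra! hc
    have h2 := representationNumber_le (by norm_num) (h.isKWordRepresentable_two (by omega))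
    rw [heq] at h2
    exact absurd h2 (by decide)
  · obtain rfl | rfl : l = 1 ∨ l = 2 := by omega
    · exact h.not_isKWordRepresentable_one hc
    · exact h.not_isKWordRepresentable_two hc
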